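/- Let $k$ be a field, let $A^\bullet$ and $B^\bullet$ be cochain complexes of $k$-vector spaces indexed by $\mathbb{Z}$ (arbitrary otherwise; complexes indexed by $\mathbb{N}$ are extended by $0$), and let $S^i : A^i \to B^{i+1}$ be linear maps that either commute with the differentials, or anticommute with them; that is, $S^{i+1}\mathrm{d} = \varepsilon\, \mathrm{d} S^i$ for all $i$, with a fixed $\varepsilon \in \{1,-1\}$. Put $K^i = \ker S^i$, a complex with the differential of $A^\bullet$, and $C^i = \operatorname{coker}(S^{i-1}) = B^i/\operatorname{im} S^{i-1}$, a complex with the differential induced by that of $B^\bullet$. Consider the double complex with two rows that has $A^p$ and, above it, $B^{p+1}$ in column $p$, with vertical maps $S^p$. Its total complex is $Z^i = B^i \oplus A^i$ with differential $(b,a) \mapsto (\mathrm{d} b + S^i a, -\varepsilon\,\mathrm{d} a)$. In the spectral sequence of the filtration of $Z^\bullet$ by columns (the one that starts with the vertical maps), the two rows of the second page are identified with $\mathcal{H}^\bullet(C^\bullet)$ and $\mathcal{H}^\bullet(K^\bullet)$, and the differential of the second page is a family of linear maps $\phi^i : \mathcal{H}^i(C^\bullet) \to \mathcal{H}^{i+1}(K^\bullet)$.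 (Explicitly, $\phi^i[b] = [-\varepsilon\,\mathrm{d} a]$ whenever $b \in B^i$, $a \in A^i$ and $\mathrm{d} b + S^i a = 0$.) Suppose that the maps $\mathcal{H}^i(A^\bullet) \to \mathcal{H}^{i+1}(B^\bullet)$ induced by $S$ on cohomology are zero for all $i$. Let $\Phi^i : C^i \to K^{i+1}$ be linear maps with $\Phi^{i+1} \mathrm{d} = \eta\, \mathrm{d}\Phi^i$ for all $i$, with a fixed $\eta \in \{1,-1\}$, which induce the maps $\phi^i$ on cohomology for all $i$. Let $Y_\Phi^\bullet$ be the mapping cone of $\Phi$: the spaces $Y_\Phi^i = K^i \oplus C^i$ with the differential $(x,c) \mapsto (\mathrm{d} x + \Phi^i c, -\eta\,\mathrm{d} c)$. Then, for every $i$, there are isomorphisms of vector spaces $$\mathcal{H}^i(Y_\Phi^\bullet) \;\cong\; \operatorname{coker} \phi^{i-1} \oplus \ker \phi^i \;\cong\; \mathcal{H}^i(A^\bullet) \oplus \mathcal{H}^i(B^\bullet).$$ -/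

import Mathlib

open CategoryTheory

universe u v

namespace BGG

noncomputable section

variable {k : Type u} [Field k]

/-- Cochain complexes of vector spaces over `k`, indexed by `ℤ`. -/
abbrev Cplx (k : Type u) [Field k] := CochainComplex (ModuleCat.{v} k) ℤ

/-- The differential `X^i → X^j` as a linear map (zero unless `i + 1 = j`). -/
abbrev diff (X : Cplx.{u, v} k) (i j : ℤ) : X.X i →ₗ[k] X.X j := (X.d i j).hom

lemma diff_diff (X : Cplx.{u, v} k) (i j l : ℤ) (x : X.X i) :
    diff X j l (diff X i j x) = 0 :=
  LinearMap.congr_fun (congrArg ModuleCat.Hom.hom (X.d_comp_d i j l)) x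

lemma diff_shape (X : Cplx.{u, v} k) (i j : ℤ) (h : i + 1 ≠ j) : diff X i j = 0 := by
  have := X.shape i j (by simpa using h)
  simp [diff, this]

lemma map_units_zsmul {M N : Type*} [AddCommGroup M] [AddCommGroup N] [Module k M] [Module k N]
    (f : M →ₗ[k] N) (ε : ℤˣ) (x : M) : f (ε • x) = ε • f x :=
  map_zsmul f (ε : ℤ) x

/-- Cocycles of degree `i`. -/
abbrev cocycles (X : Cplx.{u, v} k) (i : ℤ) : Submodule k (X.X i) :=
  LinearMap.ker (diff X i (i + 1))

/-- Coboundaries of degree `i`. -/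
abbrev coboundaries (X : Cplx.{u, v} k) (i : ℤ) : Submodule k (X.X i) :=
  LinearMap.range (diff X (i - 1) i)

lemma diff_mem_coboundaries (X : Cplx.{u, v} k) (i j : ℤ) (x : X.X i) :
    diff X i j x ∈ coboundaries X j := by
  by_cases h : i + 1 = j
  · obtain rfl : i = j - 1 := by omega
    exact ⟨x, rfl⟩
  · rw [diff_shape X i j h]
    exact Submodule.zero_mem _

/-- The homology of a complex, as provided by Mathlib, is cocycles modulo coboundaries. -/
def homologyEquiv (X : Cplx.{u, v} k) (i : ℤ) :
    (cocycles X i ⧸ (coboundaries X i).submoduleOf (cocycles X i)) ≃ₗ[k] X.homology i :=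
  (Submodule.quotEquivOfEq _ _ (by
    ext x
    constructor
    · rintro ⟨y, hy⟩
      exact ⟨y, Subtype.ext hy⟩
    · rintro ⟨y, hy⟩
      exact ⟨y, congrArg Subtype.val hy⟩)).trans
  ((X.homologyIsoSc' (i - 1) i (i + 1) (by simp) (by simp)).trans
    (X.sc' (i - 1) i (i + 1)).moduleCatHomologyIso).toLinearEquiv.symm

/-- The cohomology class of a cocycle. -/
def cls (X : Cplx.{u, v} k) (i : ℤ) : cocycles X i →ₗ[k] X.homology i :=
  (homologyEquiv X i).toLinearMap ∘ₗ Submodule.mkQ _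

lemma cls_surjective (X : Cplx.{u, v} k) (i : ℤ) : Function.Surjective (cls X i) :=
  (homologyEquiv X i).surjective.comp (Submodule.mkQ_surjective _)

lemma cls_eq_zero_iff (X : Cplx.{u, v} k) (i : ℤ) (x : cocycles X i) :
    cls X i x = 0 ↔ (x : X.X i) ∈ coboundaries X i := by
  simp only [cls, LinearMap.comp_apply, LinearEquiv.coe_coe, LinearEquiv.map_eq_zero_iff,
    Submodule.mkQ_apply, Submodule.Quotient.mk_eq_zero]
  rfl

/-- Maps `S^i : A^i → B^{i+1}` that commute (`ε = 1`) or anticommute (`ε = -1`) with the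
differentials. As for differentials, `map i j` is defined for all `i`, `j` and vanishes
unless `i + 1 = j`. -/
structure DegOneMap (ε : ℤˣ) (A B : Cplx.{u, v} k) where
  map (i j : ℤ) : A.X i →ₗ[k] B.X j
  shape (i j : ℤ) (h : i + 1 ≠ j) : map i j = 0
  comm (i j l : ℤ) (x : A.X i) : map j l (diff A i j x) = ε • diff B j l (map i j x)

namespace DegOneMap

variable {ε : ℤˣ} {A B : Cplx.{u, v} k} (S : DegOneMap ε A B)

lemma comm' (i j l : ℤ) (x : A.X i) : diff B j l (S.map i j x) = ε • S.map j l (diff A i j x) := by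
  rw [S.comm, smul_smul, Int.units_mul_self, one_smul]

lemma mem_range (i j : ℤ) (x : A.X i) : S.map i j x ∈ LinearMap.range (S.map (j - 1) j) := by
  by_cases h : i + 1 = j
  · obtain rfl : i = j - 1 := by omega
    exact ⟨x, rfl⟩
  · rw [S.shape i j h]
    exact Submodule.zero_mem _

lemma exists_of_mem_range (i j : ℤ) (h : i + 1 = j) (y : B.X j)
    (hy : y ∈ LinearMap.range (S.map (j - 1) j)) : ∃ x : A.X i, S.map i j x = y := by
  obtain rfl : i = j - 1 := by omega
  exact hy

lemma map_eq_zero_congr (i j l : ℤ) (h : j = l) (x : A.X i) :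
    S.map i j x = 0 ↔ S.map i l x = 0 := by
  subst h
  rfl

/-- The map `H^i(A) → H^j(B)`, `j = i + 1`, induced by `S` on cohomology: `[a] ↦ [S a]`. -/
def onCohomology (i j : ℤ) (h : i + 1 = j) : A.homology i →ₗ[k] B.homology j :=
  (Submodule.liftQ _
    (cls B j ∘ₗ (S.map i j).restrict (p := cocycles A i) (q := cocycles B j) (by
      intro x hx
      subst h
      rw [LinearMap.mem_ker] at hx ⊢
      rw [S.comm', hx, map_zero, smul_zero]))
    (by
      intro x hx
      obtain ⟨y, hy⟩ := hx
      rw [LinearMap.mem_ker, LinearMap.comp_apply, cls_eq_zero_iff]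
      change S.map i j x.1 ∈ _
      have hy' : diff A (i - 1) i y = x.1 := hy
      rw [← hy', S.comm, ← map_units_zsmul]
      exact diff_mem_coboundaries B i j _)) ∘ₗ (homologyEquiv A i).symm.toLinearMap

lemma onCohomology_cls (i j : ℤ) (h : i + 1 = j) (x : cocycles A i)
    (hx : S.map i j x ∈ cocycles B j) :
    S.onCohomology i j h (cls A i x) = cls B j ⟨S.map i j x, hx⟩ := by
  simp only [onCohomology, cls, LinearMap.comp_apply, LinearEquiv.coe_coe,
    LinearEquiv.symm_apply_apply]
  rfl

/-- The mapping cone of `S`: the spaces `B^i ⊕ A^i` with the differential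
`(b, a) ↦ (d b + S a, -ε d a)`. For `ε = -1` it is `(b, a) ↦ (d b + S a, d a)`. -/
def cone : Cplx.{u, v} k where
  X i := ModuleCat.of k (B.X i × A.X i)
  d i j := ModuleCat.ofHom
    (((diff B i j).coprod (S.map i j)).prod (-(ε • (diff A i j ∘ₗ LinearMap.snd k _ _))))
  shape i j h := by
    have h' : i + 1 ≠ j := by simpa using h
    rw [S.shape i j h', diff_shape A i j h', diff_shape B i j h']
    ext x <;> simp
  d_comp_d' i j l _ _ := by
    refine ModuleCat.hom_ext (LinearMap.ext fun x => Prod.ext ?_ ?_)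
    · change diff B j l (diff B i j x.1 + S.map i j x.2) + S.map j l (-(ε • diff A i j x.2)) = 0
      rw [map_add, diff_diff, map_neg, map_units_zsmul, S.comm']
      simp
    · change -(ε • diff A j l (-(ε • diff A i j x.2))) = 0
      rw [map_neg, map_units_zsmul, diff_diff]
      simp

/-- The element `(b, a)` of `B^i ⊕ A^i`. -/
def pair {i : ℤ} (b : B.X i) (a : A.X i) : S.cone.X i := ((b, a) : B.X i × A.X i)

/-- The component in `B^i`. -/
def toB (i : ℤ) : S.cone.X i →ₗ[k] B.X i := LinearMap.fst k (B.X i) (A.X i)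

/-- The component in `A^i`. -/
def toA (i : ℤ) : S.cone.X i →ₗ[k] A.X i := LinearMap.snd k (B.X i) (A.X i)

lemma cone_ext {i : ℤ} {x y : S.cone.X i} (hB : S.toB i x = S.toB i y)
    (hA : S.toA i x = S.toA i y) : x = y := Prod.ext hB hA

lemma exists_pair {i : ℤ} (x : S.cone.X i) : ∃ b a, x = S.pair b a := ⟨x.1, x.2, rfl⟩

lemma cone_diff (i j : ℤ) (b : B.X i) (a : A.X i) :
    diff S.cone i j (S.pair b a) = S.pair (diff B i j b + S.map i j a) (-(ε • diff A i j a)) := rfl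

/-- The complex `K^i = ker S^i`, with the differential of `A`. -/
def kerComplex : Cplx.{u, v} k where
  X i := ModuleCat.of k (LinearMap.ker (S.map i (i + 1)))
  d i j := ModuleCat.ofHom ((diff A i j).restrict (by
    intro x hx
    rw [LinearMap.mem_ker] at hx ⊢
    by_cases h : i + 1 = j
    · subst h
      rw [S.comm, hx, map_zero, smul_zero]
    · rw [diff_shape A i j h, LinearMap.zero_apply, map_zero]))
  shape i j h := by
    have h' : i + 1 ≠ j := by simpa using h
    ext x : 2
    apply Subtype.ext
    change diff A i j x.1 = 0
    rw [diff_shape A i j h', LinearMap.zero_apply]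
  d_comp_d' i j l _ _ := by
    ext x : 2
    apply Subtype.ext
    exact diff_diff A i j l x.1

/-- The complex `C^i = coker S^{i-1}`, with the differential induced by that of `B`. -/
def cokerComplex : Cplx.{u, v} k where
  X i := ModuleCat.of k (B.X i ⧸ LinearMap.range (S.map (i - 1) i))
  d i j := ModuleCat.ofHom (Submodule.mapQ _ _ (diff B i j) (by
    rintro _ ⟨y, rfl⟩
    rw [Submodule.mem_comap, S.comm']
    rw [← map_units_zsmul]
    exact S.mem_range i j _))
  shape i j h := by
    have h' : i + 1 ≠ j := by simpa using h
    refine ModuleCat.hom_ext (LinearMap.ext fun x => ?_)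
    obtain ⟨y, rfl⟩ := Submodule.mkQ_surjective _ x
    change Submodule.mkQ _ (diff B i j y) = 0
    rw [diff_shape B i j h', LinearMap.zero_apply, map_zero]
  d_comp_d' i j l _ _ := by
    refine ModuleCat.hom_ext (LinearMap.ext fun x => ?_)
    obtain ⟨y, rfl⟩ := Submodule.mkQ_surjective _ x
    change Submodule.mkQ _ (diff B j l (diff B i j y)) = 0
    rw [diff_diff, map_zero]

/-- The projection `B^i → C^i`. -/
def toCoker (i : ℤ) : B.X i →ₗ[k] S.cokerComplex.X i :=
  Submodule.mkQ (LinearMap.range (S.map (i - 1) i))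

/-- The inclusion `K^i → A^i`. -/
def kerIncl (i : ℤ) : S.kerComplex.X i →ₗ[k] A.X i :=
  (LinearMap.ker (S.map i (i + 1))).subtype

/-- An element of `K^i`. -/
def kerMk {i : ℤ} (a : A.X i) (h : S.map i (i + 1) a = 0) : S.kerComplex.X i :=
  (⟨a, h⟩ : LinearMap.ker (S.map i (i + 1)))

end DegOneMap

/-- A decreasing filtration `F^p X^n` of a complex by subcomplexes. -/
structure Filtration (X : Cplx.{u, v} k) where
  F (p n : ℤ) : Submodule k (X.X n)
  anti (p q n : ℤ) (h : p ≤ q) : F q n ≤ F p n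
  diff_mem (p n m : ℤ) (x : X.X n) (hx : x ∈ F p n) : diff X n m x ∈ F p m

namespace Filtration

variable {X : Cplx.{u, v} k} (Fil : Filtration X)

/-- `Z_r^p = {x ∈ F^p X^n | d x ∈ F^{p+r} X^{n+1}}`, in total degree `n`. -/
def Z (r p n : ℤ) : Submodule k (X.X n) :=
  Fil.F p n ⊓ (Fil.F (p + r) (n + 1)).comap (diff X n (n + 1))

/-- `Z_{r-1}^{p+1} + d Z_{r-1}^{p-r+1}`, in total degree `n`. -/
def Bd (r p n : ℤ) : Submodule k (X.X n) :=
  Fil.Z (r - 1) (p + 1) n ⊔ (Fil.Z (r - 1) (p - r + 1) (n - 1)).map (diff X (n - 1) n)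

/-- The term in filtration degree `p` and total degree `n` of the `r`-th page of the spectral
sequence of a filtered complex: `Z_r^p / (Z_{r-1}^{p+1} + d Z_{r-1}^{p-r+1})`. -/
abbrev page (r p n : ℤ) := Fil.Z r p n ⧸ (Fil.Bd r p n).submoduleOf (Fil.Z r p n)

lemma diff_mem_Z (r p q n m : ℤ) (hq : p + r = q) (hm : n + 1 = m) (x : X.X n)
    (hx : x ∈ Fil.Z r p n) : diff X n m x ∈ Fil.Z r q m := by
  subst hq hm
  refine ⟨hx.2, ?_⟩
  change diff X _ _ _ ∈ Fil.F _ _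
  rw [diff_diff]
  exact Submodule.zero_mem _

lemma diff_mem_Bd (r p q n m : ℤ) (hq : p + r = q) (hm : n + 1 = m) (x : X.X n)
    (hx : x ∈ Fil.Bd r p n) : diff X n m x ∈ Fil.Bd r q m := by
  obtain ⟨y, hy, _, ⟨z, _, rfl⟩, rfl⟩ := Submodule.mem_sup.1 hx
  rw [map_add, diff_diff, add_zero]
  obtain rfl : n = m - 1 := by omega
  obtain rfl : p = q - r := by omega
  exact Submodule.mem_sup_right ⟨y, hy, rfl⟩

/-- The differential of the `r`-th page, induced by the differential of the complex. -/
def pageDiff (r p q n m : ℤ) (hq : p + r = q) (hm : n + 1 = m) :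
    Fil.page r p n →ₗ[k] Fil.page r q m :=
  Submodule.mapQ _ _ ((diff X n m).restrict (Fil.diff_mem_Z r p q n m hq hm))
    (fun x hx => Fil.diff_mem_Bd r p q n m hq hm x hx)

end Filtration

namespace DegOneMap

variable {ε : ℤˣ} {A B : Cplx.{u, v} k} (S : DegOneMap ε A B)

/-- The two-row double complex has `A^p` and, above it, `B^{p+1}` in column `p`; its total complex
is the mapping cone of `S`. This is the filtration of the total complex by columns: `F^p` consists
of the entries in columns `≥ p`, where `A^n` is in column `n` and `B^n` in column `n - 1`. Its
spectral sequence is the one that starts with the vertical maps `S`. -/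
def columnFiltration : Filtration S.cone where
  F p n :=
    { carrier := {x : B.X n × A.X n | (n - 1 < p → x.1 = 0) ∧ (n < p → x.2 = 0)}
      zero_mem' := ⟨fun _ => rfl, fun _ => rfl⟩
      add_mem' := by
        rintro ⟨b, a⟩ ⟨b', a'⟩ ⟨h1, h2⟩ ⟨h1', h2'⟩
        refine ⟨fun h => ?_, fun h => ?_⟩
        · change b + b' = 0
          rw [show b = 0 from h1 h, show b' = 0 from h1' h, add_zero]
        · change a + a' = 0
          rw [show a = 0 from h2 h, show a' = 0 from h2' h, add_zero]
      smul_mem' := by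
        rintro c ⟨b, a⟩ ⟨h1, h2⟩
        refine ⟨fun h => ?_, fun h => ?_⟩
        · change c • b = 0
          rw [show b = 0 from h1 h, smul_zero]
        · change c • a = 0
          rw [show a = 0 from h2 h, smul_zero] }
  anti p q n h := fun _ hx => ⟨fun h' => hx.1 (by omega), fun h' => hx.2 (by omega)⟩
  diff_mem p n m := by
    rintro ⟨b, a⟩ ⟨h1, h2⟩
    by_cases hm : n + 1 = m
    · subst hm
      refine ⟨fun h => ?_, fun h => ?_⟩
      · change diff B n (n + 1) b + S.map n (n + 1) a = 0
        rw [show b = 0 from h1 (by omega), show a = 0 from h2 (by omega), map_zero, map_zero,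
          add_zero]
      · change -(ε • diff A n (n + 1) a) = 0
        rw [show a = 0 from h2 (by omega), map_zero, smul_zero, neg_zero]
    · rw [diff_shape S.cone n m hm]
      exact Submodule.zero_mem _

lemma mem_columnFiltration (p n : ℤ) (x : B.X n × A.X n) :
    x ∈ S.columnFiltration.F p n ↔ (n - 1 < p → x.1 = 0) ∧ (n < p → x.2 = 0) := Iff.rfl

lemma mem_Z_top (p n : ℤ) (hp : p = n - 1) (b : B.X n) (a : A.X n) :
    (S.pair b a) ∈ S.columnFiltration.Z 2 p n ↔
      diff B n (n + 1) b + S.map n (n + 1) a = 0 := by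
  subst hp
  constructor
  · intro h
    exact h.2.1 (by omega)
  · intro h
    exact ⟨⟨fun h' => by omega, fun h' => by omega⟩, fun _ => h, fun h' => by omega⟩

lemma mem_Z_bot (p n : ℤ) (hp : p = n) (b : B.X n) (a : A.X n) :
    (S.pair b a) ∈ S.columnFiltration.Z 2 p n ↔
      b = 0 ∧ S.map n (n + 1) a = 0 ∧ diff A n (n + 1) a = 0 := by
  subst hp
  constructor
  · intro h
    have hb : b = 0 := h.1.1 (by omega)
    have h1 : diff B p (p + 1) b + S.map p (p + 1) a = 0 := h.2.1 (by omega)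
    have h2 : -(ε • diff A p (p + 1) a) = 0 := h.2.2 (by omega)
    subst hb
    refine ⟨rfl, by simpa using h1, (smul_eq_zero_iff_eq ε).1 (neg_eq_zero.1 h2)⟩
  · rintro ⟨rfl, h1, h2⟩
    refine ⟨⟨fun _ => rfl, fun h' => by omega⟩, fun _ => ?_, fun _ => ?_⟩
    · change diff B p (p + 1) 0 + S.map p (p + 1) a = 0
      rw [map_zero, zero_add, h1]
    · change -(ε • diff A p (p + 1) a) = 0
      rw [h2, smul_zero, neg_zero]

lemma mem_Bd_top (p n : ℤ) (hp : p = n - 1) (b : B.X n) (a : A.X n)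
    (h : (S.pair b a) ∈ S.columnFiltration.Z 2 p n) :
    (S.pair b a) ∈ S.columnFiltration.Bd 2 p n ↔
      ∃ (b' : B.X (n - 1)) (a' : A.X (n - 1)), b = diff B (n - 1) n b' + S.map (n - 1) n a' := by
  subst hp
  rw [mem_Z_top S _ n rfl] at h
  constructor
  · intro hx
    obtain ⟨y, hy, _, ⟨z, _, rfl⟩, e⟩ := Submodule.mem_sup.1 hx
    obtain ⟨y1, y2, rfl⟩ := S.exists_pair y
    obtain ⟨b', a', rfl⟩ := S.exists_pair z
    have hy1 : y1 = 0 := hy.1.1 (by omega)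
    have e1 : y1 + (diff B (n - 1) n b' + S.map (n - 1) n a') = b := congrArg (S.toB _) e
    exact ⟨b', a', by rw [← e1, hy1, zero_add]⟩
  · rintro ⟨b', a', rfl⟩
    refine Submodule.mem_sup.2 ⟨S.pair 0 (a + ε • diff A (n - 1) n a'), ?_,
      diff S.cone (n - 1) n (S.pair b' a'), ⟨_, ?_, rfl⟩, ?_⟩
    · refine ⟨⟨fun _ => rfl, fun h' => by omega⟩, fun _ => ?_, fun h' => by omega⟩
      change diff B n (n + 1) 0 + S.map n (n + 1) (a + ε • diff A (n - 1) n a') = 0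
      rw [map_add, diff_diff, zero_add, S.comm'] at h
      rw [map_zero, zero_add, map_add, map_units_zsmul, add_comm (S.map _ _ a), h]
    · exact ⟨⟨fun h' => by omega, fun h' => by omega⟩, fun h' => by omega, fun h' => by omega⟩
    · rw [cone_diff]
      refine S.cone_ext ?_ ?_
      · exact zero_add _
      · change a + ε • diff A (n - 1) n a' + -(ε • diff A (n - 1) n a') = a
        abel

lemma mem_Bd_bot (p n : ℤ) (hp : p = n) (a : A.X n) :
    (S.pair 0 a) ∈ S.columnFiltration.Bd 2 p n ↔
      ∃ a' : A.X (n - 1), S.map (n - 1) n a' = 0 ∧ a = diff A (n - 1) n a' := by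
  subst hp
  constructor
  · intro hx
    obtain ⟨y, hy, _, ⟨z, hz, rfl⟩, e⟩ := Submodule.mem_sup.1 hx
    obtain ⟨y1, y2, rfl⟩ := S.exists_pair y
    obtain ⟨b', a', rfl⟩ := S.exists_pair z
    have hy2 : y2 = 0 := hy.1.2 (by omega)
    have hb' : b' = 0 := hz.1.1 (by omega)
    have hz' : diff B (p - 1) (p - 1 + 1) b' + S.map (p - 1) (p - 1 + 1) a' = 0 :=
      hz.2.1 (by omega)
    have e2 : y2 + -(ε • diff A (p - 1) p a') = a := congrArg (S.toA _) e
    rw [hb', map_zero, zero_add, S.map_eq_zero_congr _ _ p (by omega)] at hz'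
    refine ⟨-(ε • a'), ?_, ?_⟩
    · rw [map_neg, map_units_zsmul, hz', smul_zero, neg_zero]
    · rw [map_neg, map_units_zsmul, ← e2, hy2, zero_add]
  · rintro ⟨a', h, rfl⟩
    refine Submodule.mem_sup_right ⟨(S.pair 0 (-(ε • a'))), ?_, ?_⟩
    · refine ⟨⟨fun _ => rfl, fun h' => by omega⟩, fun _ => ?_, fun h' => by omega⟩
      change diff B (p - 1) (p - 1 + 1) 0 + S.map (p - 1) (p - 1 + 1) (-(ε • a')) = 0
      rw [map_zero, zero_add, map_neg, map_units_zsmul,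
        (S.map_eq_zero_congr _ _ p (by omega) a').2 h, smul_zero, neg_zero]
    · rw [cone_diff]
      refine S.cone_ext ?_ ?_
      · change diff B (p - 1) p 0 + S.map (p - 1) p (-(ε • a')) = 0
        rw [map_zero, zero_add, map_neg, map_units_zsmul, h, smul_zero, neg_zero]
      · change -(ε • diff A (p - 1) p (-(ε • a'))) = diff A (p - 1) p a'
        rw [map_neg, map_units_zsmul, smul_neg, neg_neg, smul_smul, Int.units_mul_self, one_smul]

/-- `(b, a) ↦ [b]`, from `Z_2` in the row of `B` to `H^n(C)`. -/
def topClass (p n : ℤ) (hp : p = n - 1) :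
    S.columnFiltration.Z 2 p n →ₗ[k] S.cokerComplex.homology n :=
  cls S.cokerComplex n ∘ₗ
    LinearMap.restrict (p := S.columnFiltration.Z 2 p n) (q := cocycles S.cokerComplex n)
      (S.toCoker n ∘ₗ S.toB n) (by
        intro x h
        obtain ⟨b, a, rfl⟩ := S.exists_pair x
        rw [mem_Z_top S p n hp, ← eq_neg_iff_add_eq_zero] at h
        change Submodule.mkQ _ (diff B n (n + 1) b) = 0
        rw [h, ← map_neg, Submodule.mkQ_apply, Submodule.Quotient.mk_eq_zero]
        exact S.mem_range _ _ _)

/-- `(0, a) ↦ [a]`, from `Z_2` in the row of `A` to `H^n(K)`. -/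
def botClass (p n : ℤ) (hp : p = n) :
    S.columnFiltration.Z 2 p n →ₗ[k] S.kerComplex.homology n :=
  cls S.kerComplex n ∘ₗ
    LinearMap.codRestrict (cocycles S.kerComplex n)
      (LinearMap.codRestrict (LinearMap.ker (S.map n (n + 1)))
        (S.toA n ∘ₗ (S.columnFiltration.Z 2 p n).subtype)
        (by
          rintro ⟨x, h⟩
          obtain ⟨b, a, rfl⟩ := S.exists_pair x
          exact ((mem_Z_bot S p n hp b a).1 h).2.1))
      (by
        rintro ⟨x, h⟩
        obtain ⟨b, a, rfl⟩ := S.exists_pair x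
        exact Subtype.ext ((mem_Z_bot S p n hp b a).1 h).2.2)

/-- The identification of the row of `B` on the second page with the cohomology of `C`;
the class of `(b, a)` with `d b + S a = 0` goes to the class of `b`. -/
def pageTwoTop (p n : ℤ) (hp : p = n - 1) :
    S.columnFiltration.page 2 p n ≃ₗ[k] S.cokerComplex.homology n :=
  (Submodule.quotEquivOfEq _ _ (by
    ext ⟨x, h⟩
    obtain ⟨b, a, rfl⟩ := S.exists_pair x
    rw [LinearMap.mem_ker, topClass, LinearMap.comp_apply, cls_eq_zero_iff]
    change (S.pair b a) ∈ S.columnFiltration.Bd 2 p n ↔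
      S.toCoker n b ∈ coboundaries S.cokerComplex n
    rw [mem_Bd_top S p n hp b a h]
    constructor
    · rintro ⟨b', a', rfl⟩
      refine ⟨Submodule.mkQ _ b', ?_⟩
      change S.toCoker n (diff B (n - 1) n b') = _
      rw [map_add, left_eq_add]
      refine (Submodule.Quotient.mk_eq_zero _).2 ?_
      exact ⟨a', rfl⟩
    · rintro ⟨c, hc⟩
      obtain ⟨b', rfl⟩ := Submodule.mkQ_surjective _ c
      have hc' : Submodule.mkQ (LinearMap.range (S.map (n - 1) n)) b =
        Submodule.mkQ _ (diff B (n - 1) n b') := hc.symm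
      obtain ⟨a', ha'⟩ := (Submodule.Quotient.eq _).1 hc'
      exact ⟨b', a', by rw [ha']; abel⟩)).trans
  ((S.topClass p n hp).quotKerEquivOfSurjective (by
    intro x
    obtain ⟨⟨c, hc⟩, rfl⟩ := cls_surjective _ _ x
    obtain ⟨b, rfl⟩ := Submodule.mkQ_surjective _ c
    have hb : Submodule.mkQ _ (diff B n (n + 1) b) = 0 := hc
    rw [Submodule.mkQ_apply, Submodule.Quotient.mk_eq_zero] at hb
    obtain ⟨a, ha⟩ := S.exists_of_mem_range n (n + 1) rfl _ hb
    refine ⟨⟨(S.pair b (-a)), ?_⟩, rfl⟩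
    rw [mem_Z_top S p n hp, map_neg, ha, add_neg_cancel]))

/-- The identification of the row of `A` on the second page with the cohomology of `K`;
the class of `(0, a)` with `S a = 0` and `d a = 0` goes to the class of `a`. -/
def pageTwoBot (p n : ℤ) (hp : p = n) :
    S.columnFiltration.page 2 p n ≃ₗ[k] S.kerComplex.homology n :=
  (Submodule.quotEquivOfEq _ _ (by
    ext ⟨x, h⟩
    obtain ⟨b, a, rfl⟩ := S.exists_pair x
    rw [LinearMap.mem_ker, botClass, LinearMap.comp_apply, cls_eq_zero_iff]
    obtain ⟨rfl, h1, h2⟩ := (mem_Z_bot S p n hp b a).1 h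
    change (S.pair 0 a) ∈ S.columnFiltration.Bd 2 p n ↔
      S.kerMk a h1 ∈ coboundaries S.kerComplex n
    rw [mem_Bd_bot S p n hp a]
    constructor
    · rintro ⟨a', h', rfl⟩
      exact ⟨⟨a', (S.map_eq_zero_congr _ _ _ (by omega) a').2 h'⟩, rfl⟩
    · rintro ⟨⟨a', h'⟩, e⟩
      exact ⟨a', (S.map_eq_zero_congr _ _ _ (by omega) a').1 h',
        (congrArg Subtype.val e).symm⟩)).trans
  ((S.botClass p n hp).quotKerEquivOfSurjective (by
    intro x
    obtain ⟨⟨c, hc⟩, rfl⟩ := cls_surjective _ _ x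
    obtain ⟨a, ha⟩ := c
    exact ⟨⟨(S.pair 0 a), (mem_Z_bot S p n hp 0 a).2
      ⟨rfl, ha, congrArg Subtype.val hc⟩⟩, rfl⟩))

/-- The maps `φ^i : H^i(C) → H^{i+1}(K)`: the differential of the second page. -/
def phi (i j : ℤ) (h : i + 1 = j) :
    S.cokerComplex.homology i →ₗ[k] S.kerComplex.homology j :=
  (S.pageTwoBot j j rfl).toLinearMap ∘ₗ
    S.columnFiltration.pageDiff 2 (i - 1) j i j (by omega) h ∘ₗ
    (S.pageTwoTop (i - 1) i rfl).symm.toLinearMap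

/-- Explicitly: if `d b + S a = 0`, then `φ [b] = [-ε d a]`. -/
lemma phi_cls (i j : ℤ) (h : i + 1 = j) (b : B.X i) (a : A.X i)
    (hba : diff B i j b + S.map i j a = 0)
    (hb : S.toCoker i b ∈ cocycles S.cokerComplex i)
    (ha : S.map j (j + 1) (-(ε • diff A i j a)) = 0)
    (ha' : S.kerMk (-(ε • diff A i j a)) ha ∈ cocycles S.kerComplex j) :
    S.phi i j h (cls S.cokerComplex i ⟨S.toCoker i b, hb⟩) =
      cls S.kerComplex j ⟨S.kerMk (-(ε • diff A i j a)) ha, ha'⟩ := by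
  subst h
  have hz := (S.mem_Z_top (i - 1) i rfl b a).2 hba
  have e : cls S.cokerComplex i ⟨S.toCoker i b, hb⟩ =
      S.pageTwoTop (i - 1) i rfl (Submodule.mkQ _ ⟨S.pair b a, hz⟩) := rfl
  rw [e, phi, LinearMap.comp_apply, LinearMap.comp_apply, LinearEquiv.coe_coe, LinearEquiv.coe_coe,
    LinearEquiv.symm_apply_apply]
  rfl

end DegOneMap

end

end BGG

/-!
Two "short exact sequences" run through the total complex `Z` of the double complex:
`0 → B → Z → A → 0`, and `0 → K → Z → C → 0`, which is exact up to the acyclic complex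
`im S → im S`. The first has the map induced by `S` as its connecting map, the second has `φ`.
In a long exact sequence of vector spaces every term is the sum of the adjacent cokernel and kernel,
so `H(Z) ≅ coker S_* ⊕ ker S_*` and `H(Z) ≅ coker φ ⊕ ker φ`. When `S_* = 0` the former is
`H(B) ⊕ H(A)`. The first sequence for `Φ` in place of `S` gives `H(Y_Φ) ≅ coker φ ⊕ ker φ`.
-/

namespace BGG

noncomputable section

lemma nonempty_equiv_quotient_range_prod_ker {R V X Y W U : Type*} [Ring R]
    [AddCommGroup V] [AddCommGroup X] [AddCommGroup Y] [AddCommGroup W] [AddCommGroup U]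
    [Module R V] [Module R X] [Module R Y] [Module R W] [Module R U]
    {f : V →ₗ[R] X} {g : X →ₗ[R] Y} {h : Y →ₗ[R] W} {m : W →ₗ[R] U}
    [Module.Projective R (LinearMap.ker m)]
    (hfg : Function.Exact f g) (hgh : Function.Exact g h) (hhm : Function.Exact h m) :
    Nonempty (Y ≃ₗ[R] (X ⧸ LinearMap.range f) × LinearMap.ker m) := by
  let ι : (X ⧸ LinearMap.range f) →ₗ[R] Y := (LinearMap.range f).liftQ g fun x => (hfg x).2
  let π : Y →ₗ[R] LinearMap.ker m := h.codRestrict (LinearMap.ker m) hhm.apply_apply_eq_zero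
  have hι : Function.Injective ι := LinearMap.injective_range_liftQ_of_exact hfg
  have hπ : LinearMap.range π = ⊤ := by
    refine LinearMap.range_eq_top.2 fun ⟨w, hw⟩ => ?_
    obtain ⟨y, rfl⟩ := (hhm w).1 hw
    exact ⟨y, rfl⟩
  have hιπ : Function.Exact ι π := fun y =>
    calc π y = 0 ↔ h y = 0 := Subtype.ext_iff
      _ ↔ ∃ x, g x = y := hgh y
      _ ↔ ∃ c, ι c = y := (Submodule.mkQ_surjective _).exists (p := fun c => ι c = y) |>.symm
  obtain ⟨σ, hσ⟩ := π.exists_rightInverse_of_surjective hπ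
  exact ⟨(hιπ.splitSurjectiveEquiv hι ⟨σ, hσ⟩).1⟩

variable {k : Type u} [Field k]

section Classes

variable (X : Cplx.{u, v} k) {i j : ℤ}

lemma mem_cocycles_iff (h : i + 1 = j) {x : X.X i} : x ∈ cocycles X i ↔ diff X i j x = 0 := by
  subst h
  exact LinearMap.mem_ker

lemma cls_mk_eq_zero_iff (h : i + 1 = j) {x : X.X j} (hx : x ∈ cocycles X j) :
    cls X j ⟨x, hx⟩ = 0 ↔ ∃ y, diff X i j y = x := by
  obtain rfl : i = j - 1 := by lia
  exact cls_eq_zero_iff X j ⟨x, hx⟩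

lemma cls_mk_eq_iff (h : i + 1 = j) {x y : X.X j} (hx : x ∈ cocycles X j)
    (hy : y ∈ cocycles X j) :
    cls X j ⟨x, hx⟩ = cls X j ⟨y, hy⟩ ↔ ∃ z, diff X i j z = x - y := by
  rw [← sub_eq_zero, ← map_sub]
  exact cls_mk_eq_zero_iff X h (Submodule.sub_mem _ hx hy)

end Classes

/-- Linear maps `X^i → Y^i` that commute (`ε = 1`) or anticommute (`ε = -1`) with the
differentials: the counterpart in degree zero of `DegOneMap`. -/
structure SignedHom (ε : ℤˣ) (X Y : Cplx.{u, v} k) where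
  map (i : ℤ) : X.X i →ₗ[k] Y.X i
  comm (i j : ℤ) (x : X.X i) : map j (diff X i j x) = ε • diff Y i j (map i x)

namespace SignedHom

variable {ε : ℤˣ} {X Y : Cplx.{u, v} k} (f : SignedHom ε X Y)

lemma diff_map_smul (i j : ℤ) (x : X.X i) :
    diff Y i j (f.map i (ε • x)) = f.map j (diff X i j x) := by
  rw [f.comm, map_units_zsmul, map_units_zsmul]

lemma diff_map (i j : ℤ) (x : X.X i) : diff Y i j (f.map i x) = ε • f.map j (diff X i j x) := by
  rw [f.comm, smul_smul, Int.units_mul_self, one_smul]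

lemma map_mem_cocycles {i : ℤ} {x : X.X i} (hx : x ∈ cocycles X i) :
    f.map i x ∈ cocycles Y i := by
  rw [LinearMap.mem_ker, f.diff_map, LinearMap.mem_ker.1 hx, map_zero, smul_zero]

lemma map_mem_coboundaries {i : ℤ} {x : X.X i} (hx : x ∈ coboundaries X i) :
    f.map i x ∈ coboundaries Y i := by
  obtain ⟨y, rfl⟩ := hx
  rw [← f.diff_map_smul]
  exact LinearMap.mem_range_self _ _

/-- The map `H^i(X) → H^i(Y)` induced on cohomology: `[x] ↦ [f x]`. -/
def onCohomology (i : ℤ) : X.homology i →ₗ[k] Y.homology i :=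
  Submodule.liftQ _ (cls Y i ∘ₗ (f.map i).restrict fun _ => f.map_mem_cocycles)
    (fun _ hx => (cls_eq_zero_iff Y i _).2 (f.map_mem_coboundaries hx)) ∘ₗ
    (homologyEquiv X i).symm.toLinearMap

lemma onCohomology_cls {i : ℤ} {x : X.X i} (hx : x ∈ cocycles X i) :
    f.onCohomology i (cls X i ⟨x, hx⟩) = cls Y i ⟨f.map i x, f.map_mem_cocycles hx⟩ := by
  simp only [onCohomology, cls, LinearMap.comp_apply, LinearEquiv.coe_coe,
    LinearEquiv.symm_apply_apply]
  rfl

end SignedHom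

section QuasiShortExact

variable {α β : ℤˣ} {X Y Z : Cplx.{u, v} k} {f : SignedHom α X Y} {g : SignedHom β Y Z}

/-- The sequence `0 → X → Y → Z → 0` is exact, except that in the middle `ker g / im f` is only
required to be acyclic. This is what the long exact cohomology sequence needs. -/
structure IsQuasiShortExact (f : SignedHom α X Y) (g : SignedHom β Y Z) : Prop where
  injective (i : ℤ) : Function.Injective (f.map i)
  surjective (i : ℤ) : Function.Surjective (g.map i)
  map_map (i : ℤ) (x : X.X i) : g.map i (f.map i x) = 0
  acyclic {i j l : ℤ} (hij : i + 1 = j) (hjl : j + 1 = l) (y : Y.X j) (x : X.X l)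
    (hy : g.map j y = 0) (hyx : diff Y j l y = f.map l x) :
    ∃ (x' : X.X j) (y' : Y.X i), g.map i y' = 0 ∧ y = f.map j x' + diff Y i j y'

/-- The map `δ : H^i(Z) → H^j(X)`, `j = i + 1`, is given by the snake rule: `δ [g y] = [x]` whenever
`d y = f x`. -/
def IsConnecting (f : SignedHom α X Y) (g : SignedHom β Y Z) {i j : ℤ}
    (δ : Z.homology i →ₗ[k] X.homology j) : Prop :=
  ∀ (y : Y.X i) (x : X.X j) (hy : g.map i y ∈ cocycles Z i) (hx : x ∈ cocycles X j),
    diff Y i j y = f.map j x → δ (cls Z i ⟨g.map i y, hy⟩) = cls X j ⟨x, hx⟩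

namespace IsQuasiShortExact

variable (hfg : IsQuasiShortExact f g)
include hfg

lemma mem_cocycles_of_map {i : ℤ} {x : X.X i} (hx : f.map i x ∈ cocycles Y i) :
    x ∈ cocycles X i := by
  refine hfg.injective (i + 1) ?_
  rw [f.comm, LinearMap.mem_ker.1 hx, smul_zero, map_zero]

lemma exists_lift {i j : ℤ} (h : i + 1 = j) {z : Z.X i} (hz : z ∈ cocycles Z i) :
    ∃ (y : Y.X i) (x : X.X j), g.map i y = z ∧ x ∈ cocycles X j ∧ diff Y i j y = f.map j x := by
  obtain ⟨y, rfl⟩ := hfg.surjective i z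
  have hdy : g.map j (diff Y i j y) = 0 := by
    rw [g.comm, (mem_cocycles_iff Z h).1 hz, smul_zero]
  obtain ⟨x, y', hy', hyx⟩ := hfg.acyclic h rfl (diff Y i j y) 0 hdy
    (by rw [diff_diff, map_zero])
  have hx : f.map j x = diff Y i j (y - y') := by rw [map_sub, hyx, add_sub_cancel_right]
  refine ⟨y - y', x, by rw [map_sub, hy', sub_zero], hfg.mem_cocycles_of_map ?_, hx.symm⟩
  rw [hx, LinearMap.mem_ker, diff_diff]

lemma exact_connecting {i j : ℤ} (h : i + 1 = j) {δ : Z.homology i →ₗ[k] X.homology j}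
    (hδ : IsConnecting f g δ) : Function.Exact δ (f.onCohomology j) := by
  intro c
  obtain ⟨⟨x, hx⟩, rfl⟩ := cls_surjective X j c
  rw [f.onCohomology_cls, cls_mk_eq_zero_iff Y h]
  constructor
  · rintro ⟨y, hy⟩
    have hgy : g.map i y ∈ cocycles Z i := by
      rw [mem_cocycles_iff Z h, g.diff_map, hy, hfg.map_map, smul_zero]
    exact ⟨cls Z i ⟨g.map i y, hgy⟩, hδ y x hgy hx hy⟩
  · rintro ⟨c, hc⟩
    obtain ⟨⟨z, hz⟩, rfl⟩ := cls_surjective Z i c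
    obtain ⟨y, x', rfl, hx', hyx⟩ := hfg.exists_lift h hz
    rw [hδ y x' hz hx' hyx, cls_mk_eq_iff X h] at hc
    obtain ⟨x'', hx''⟩ := hc
    refine ⟨y - f.map i (α • x''), ?_⟩
    rw [map_sub, hyx, f.diff_map_smul, hx'', map_sub, sub_sub_cancel]

lemma exact_onCohomology (i : ℤ) : Function.Exact (f.onCohomology i) (g.onCohomology i) := by
  have h : i - 1 + 1 = i := sub_add_cancel i 1
  intro c
  constructor
  · obtain ⟨⟨y, hy⟩, rfl⟩ := cls_surjective Y i c
    rw [g.onCohomology_cls, cls_mk_eq_zero_iff Z h]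
    rintro ⟨z, hz⟩
    obtain ⟨y₀, rfl⟩ := hfg.surjective _ z
    have hgy : g.map i (y - diff Y (i - 1) i (β • y₀)) = 0 := by
      rw [map_sub, ← hz, ← g.diff_map_smul, smul_smul, Int.units_mul_self, one_smul, sub_self]
    obtain ⟨x, y', -, hxy'⟩ := hfg.acyclic h rfl _ 0 hgy
      (by rw [map_sub, diff_diff, LinearMap.mem_ker.1 hy, map_zero, sub_zero])
    have hxy : y - f.map i x = diff Y (i - 1) i (y' + β • y₀) := by
      rw [map_add, sub_eq_iff_eq_add', ← add_assoc, ← hxy', sub_add_cancel]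
    have hx : x ∈ cocycles X i := hfg.mem_cocycles_of_map <| by
      rw [← sub_sub_cancel y (f.map i x), hxy]
      exact Submodule.sub_mem _ hy (diff_diff Y _ _ _ _)
    refine ⟨cls X i ⟨x, hx⟩, ?_⟩
    rw [f.onCohomology_cls, eq_comm, cls_mk_eq_iff Y h]
    exact ⟨_, hxy.symm⟩
  · rintro ⟨c, rfl⟩
    obtain ⟨⟨x, hx⟩, rfl⟩ := cls_surjective X i c
    rw [f.onCohomology_cls, g.onCohomology_cls, cls_mk_eq_zero_iff Z h]
    exact ⟨0, by rw [hfg.map_map, map_zero]⟩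

lemma exact_onCohomology_connecting {i j : ℤ} (h : i + 1 = j)
    {δ : Z.homology i →ₗ[k] X.homology j} (hδ : IsConnecting f g δ) :
    Function.Exact (g.onCohomology i) δ := by
  intro c
  constructor
  · obtain ⟨⟨z, hz⟩, rfl⟩ := cls_surjective Z i c
    obtain ⟨y, x, rfl, hx, hyx⟩ := hfg.exists_lift h hz
    rw [hδ y x hz hx hyx, cls_mk_eq_zero_iff X h]
    rintro ⟨x', rfl⟩
    have hy : y - f.map i (α • x') ∈ cocycles Y i := by
      rw [mem_cocycles_iff Y h, map_sub, f.diff_map_smul, hyx, sub_self]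
    refine ⟨cls Y i ⟨_, hy⟩, ?_⟩
    simp only [g.onCohomology_cls, map_sub, hfg.map_map, sub_zero]
  · rintro ⟨c, rfl⟩
    obtain ⟨⟨y, hy⟩, rfl⟩ := cls_surjective Y i c
    have hy0 : diff Y i j y = f.map j 0 := by rw [(mem_cocycles_iff Y h).1 hy, map_zero]
    rw [g.onCohomology_cls, hδ y 0 _ (Submodule.zero_mem _) hy0, cls_mk_eq_zero_iff X h]
    exact ⟨0, map_zero _⟩

theorem nonempty_homology_equiv {i j l : ℤ} (hij : i + 1 = j) (hjl : j + 1 = l)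
    {δ : Z.homology i →ₗ[k] X.homology j} {δ' : Z.homology j →ₗ[k] X.homology l}
    (hδ : IsConnecting f g δ) (hδ' : IsConnecting f g δ') :
    Nonempty (Y.homology j ≃ₗ[k] (X.homology j ⧸ LinearMap.range δ) × LinearMap.ker δ') :=
  nonempty_equiv_quotient_range_prod_ker (hfg.exact_connecting hij hδ) (hfg.exact_onCohomology j)
    (hfg.exact_onCohomology_connecting hjl hδ')

end IsQuasiShortExact

end QuasiShortExact

namespace DegOneMap

variable {ε : ℤˣ} {A B : Cplx.{u, v} k} (S : DegOneMap ε A B)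

lemma toCoker_eq_zero_iff {i j : ℤ} (h : i + 1 = j) {b : B.X j} :
    S.toCoker j b = 0 ↔ ∃ a : A.X i, S.map i j a = b := by
  obtain rfl : i = j - 1 := by lia
  exact Submodule.Quotient.mk_eq_zero _

lemma toCoker_map (i j : ℤ) (a : A.X i) : S.toCoker j (S.map i j a) = 0 :=
  (Submodule.Quotient.mk_eq_zero _).2 (S.mem_range i j a)

lemma map_eq_zero_of_mem_ker {i j : ℤ} {a : A.X i} (ha : a ∈ LinearMap.ker (S.map i (i + 1))) :
    S.map i j a = 0 := by
  by_cases h : i + 1 = j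
  · exact (S.map_eq_zero_congr i _ j h a).1 ha
  · rw [S.shape i j h, LinearMap.zero_apply]

lemma map_mem_cocycles {i j : ℤ} (h : i + 1 = j) {a : A.X i} (ha : a ∈ cocycles A i) :
    S.map i j a ∈ cocycles B j := by
  rw [LinearMap.mem_ker, S.comm', (mem_cocycles_iff A h).1 ha, map_zero, smul_zero]

/-- The inclusion `B → Z` into the cone `Z` of `S`, `b ↦ (b, 0)`. -/
def coneInclB : SignedHom 1 B S.cone where
  map i := LinearMap.inl k (B.X i) (A.X i)
  comm i j b := by
    change S.pair (diff B i j b) 0 = (1 : ℤˣ) • diff S.cone i j (S.pair b 0)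
    rw [one_smul, cone_diff, map_zero, add_zero, map_zero, smul_zero, neg_zero]

/-- The projection `Z → A` from the cone `Z` of `S`, `(b, a) ↦ a`. -/
def coneProjA : SignedHom (-ε) S.cone A where
  map := S.toA
  comm i j y := (Units.neg_smul ε (diff A i j (S.toA i y))).symm

/-- The inclusion `K → Z` into the cone `Z` of `S`, `a ↦ (0, a)`. -/
def coneInclKer : SignedHom (-ε) S.kerComplex S.cone where
  map i := LinearMap.inr k (B.X i) (A.X i) ∘ₗ S.kerIncl i
  comm i j := by
    rintro ⟨a, ha⟩
    change S.pair 0 (diff A i j a) = (-ε) • diff S.cone i j (S.pair 0 a)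
    rw [cone_diff, map_zero, zero_add, S.map_eq_zero_of_mem_ker ha]
    refine S.cone_ext (smul_zero (-ε)).symm ?_
    change diff A i j a = (-ε) • -(ε • diff A i j a)
    rw [Units.neg_smul, smul_neg, neg_neg, smul_smul, Int.units_mul_self, one_smul]

/-- The projection `Z → C` from the cone `Z` of `S`, `(b, a) ↦ [b]`. -/
def coneProjCoker : SignedHom 1 S.cone S.cokerComplex where
  map i := S.toCoker i ∘ₗ S.toB i
  comm i j y := by
    change S.toCoker j (diff B i j (S.toB i y) + S.map i j (S.toA i y)) =
      (1 : ℤˣ) • S.toCoker j (diff B i j (S.toB i y))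
    rw [map_add, S.toCoker_map, add_zero, one_smul]

lemma isQuasiShortExact_coneInclB_coneProjA : IsQuasiShortExact S.coneInclB S.coneProjA where
  injective _ := LinearMap.inl_injective
  surjective _ := LinearMap.snd_surjective
  map_map _ _ := rfl
  acyclic _ _ y _ hy _ := by
    refine ⟨S.toB _ y, 0, map_zero _, ?_⟩
    rw [map_zero, add_zero]
    exact S.cone_ext rfl hy

lemma isConnecting_onCohomology {i j : ℤ} (h : i + 1 = j) :
    IsConnecting S.coneInclB S.coneProjA (S.onCohomology i j h) := by
  intro y b' ha hb' hy
  obtain ⟨b, a, rfl⟩ := S.exists_pair y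
  have hb : diff B i j b + S.map i j a = b' := congrArg (S.toB j) hy
  refine (S.onCohomology_cls i j h ⟨a, ha⟩ (S.map_mem_cocycles h ha)).trans ?_
  rw [cls_mk_eq_iff B h]
  exact ⟨-b, by rw [map_neg, ← hb]; abel⟩

lemma isQuasiShortExact_coneInclKer_coneProjCoker :
    IsQuasiShortExact S.coneInclKer S.coneProjCoker where
  injective _ := LinearMap.inr_injective.comp Subtype.val_injective
  surjective _ := (Submodule.mkQ_surjective _).comp LinearMap.fst_surjective
  map_map i _ := map_zero (S.toCoker i)
  acyclic {i j l} hij hjl y _ hy hyx := by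
    obtain ⟨b, a, rfl⟩ := S.exists_pair y
    obtain ⟨a₀, rfl⟩ := (S.toCoker_eq_zero_iff hij).1 hy
    have hS : S.map j l (a + ε • diff A i j a₀) = 0 := by
      rw [map_add, map_units_zsmul, ← S.comm', add_comm]
      exact congrArg (S.toB l) hyx
    refine ⟨S.kerMk _ ((S.map_eq_zero_congr j l _ hjl.symm _).1 hS), S.pair 0 a₀,
      map_zero (S.toCoker i), ?_⟩
    rw [cone_diff, map_zero, zero_add]
    exact S.cone_ext (zero_add _).symm (add_neg_cancel_right _ _).symm

lemma isConnecting_phi {i j : ℤ} (h : i + 1 = j) :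
    IsConnecting S.coneInclKer S.coneProjCoker (S.phi i j h) := by
  rintro y ⟨a', ha'⟩ hb hx hy
  obtain ⟨b, a, rfl⟩ := S.exists_pair y
  obtain rfl : -(ε • diff A i j a) = a' := congrArg (S.toA j) hy
  exact S.phi_cls i j h b a (congrArg (S.toB j) hy) hb ha' hx

theorem nonempty_cone_homology_equiv_onCohomology (i : ℤ) :
    Nonempty (S.cone.homology i ≃ₗ[k]
      (B.homology i ⧸ LinearMap.range (S.onCohomology (i - 1) i (sub_add_cancel i 1))) ×
        LinearMap.ker (S.onCohomology i (i + 1) rfl)) :=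
  S.isQuasiShortExact_coneInclB_coneProjA.nonempty_homology_equiv (sub_add_cancel i 1) rfl
    (S.isConnecting_onCohomology _) (S.isConnecting_onCohomology _)

theorem nonempty_cone_homology_equiv_phi (i : ℤ) :
    Nonempty (S.cone.homology i ≃ₗ[k]
      (S.kerComplex.homology i ⧸ LinearMap.range (S.phi (i - 1) i (sub_add_cancel i 1))) ×
        LinearMap.ker (S.phi i (i + 1) rfl)) :=
  S.isQuasiShortExact_coneInclKer_coneProjCoker.nonempty_homology_equiv (sub_add_cancel i 1) rfl
    (S.isConnecting_phi _) (S.isConnecting_phi _)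

theorem nonempty_cone_homology_equiv_prod {i : ℤ}
    (hi : S.onCohomology (i - 1) i (sub_add_cancel i 1) = 0)
    (hi' : S.onCohomology i (i + 1) rfl = 0) :
    Nonempty (S.cone.homology i ≃ₗ[k] A.homology i × B.homology i) := by
  obtain ⟨e⟩ := S.nonempty_cone_homology_equiv_onCohomology i
  let eB := Submodule.quotEquivOfEqBot _ ((LinearMap.range_eq_bot).2 hi)
  let eA := LinearEquiv.ofTop _ ((LinearMap.ker_eq_top).2 hi')
  exact ⟨e.trans ((eB.prodCongr eA).trans (LinearEquiv.prodComm k _ _))⟩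

end DegOneMap

end

end BGG

theorem mainTheorem4 {k : Type u} [Field k] (ε η : ℤˣ)
    (A B : CochainComplex (ModuleCat.{v} k) ℤ)
    (S : BGG.DegOneMap ε A B)
    (hS : ∀ (i j : ℤ) (h : i + 1 = j), S.onCohomology i j h = 0)
    (Φ : BGG.DegOneMap η S.cokerComplex S.kerComplex)
    (hΦ : ∀ (i j : ℤ) (h : i + 1 = j), Φ.onCohomology i j h = S.phi i j h)
    (i : ℤ) :
    Nonempty (Φ.cone.homology i ≃ₗ[k]
      (S.kerComplex.homology i ⧸ LinearMap.range (S.phi (i - 1) i (sub_add_cancel i 1))) ×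
        LinearMap.ker (S.phi i (i + 1) rfl)) ∧
    Nonempty (((S.kerComplex.homology i ⧸
        LinearMap.range (S.phi (i - 1) i (sub_add_cancel i 1))) ×
        LinearMap.ker (S.phi i (i + 1) rfl)) ≃ₗ[k]
      A.homology i × B.homology i) := by
  obtain ⟨eΦ⟩ := Φ.nonempty_cone_homology_equiv_onCohomology i
  obtain ⟨eS⟩ := S.nonempty_cone_homology_equiv_phi i
  obtain ⟨eAB⟩ := S.nonempty_cone_homology_equiv_prod (hS _ _ _) (hS _ _ _)
  rw [← hΦ, ← hΦ] at eS ⊢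
  exact ⟨⟨eΦ⟩, ⟨eS.symm.trans eAB⟩⟩
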